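/- Let $N\ge 2$, $P>0$, $\alpha>2$, $\tau\in[0,1)$, $r_B>0$, $R_S>0$, $\lambda_E>0$, and let $\mathcal{CN}(0,1)$ denote the circularly symmetric complex Gaussian law of unit variance. A transmitter (Alice) with $N$ antennas sits at the origin of the plane. Fix the (nonzero) realization $\hat{\bm h}_b\in\mathbb{C}^N\setminus\{0\}$ of the estimated channel to the legitimate receiver (Bob), let $\bm w$ be the entrywise complex conjugate of $\hat{\bm h}_b$ divided by $\|\hat{\bm h}_b\|$, and let $\bm G\in\mathbb{C}^{N\times(N-1)}$ be any matrix such that the columns of $[\bm w\ \bm G]$ are orthonormal. The eavesdroppers (Eves), indexed by $k$, are located at the points of a homogeneous Poisson point process (PPP) $\Phi_E$ of density $\lambda_E$ on $\mathbb{R}^2$; $r_k$ is the distance of the $k$-th Eve from the origin, and its fading vector $\bm h_{e,k}\in\mathbb{C}^N$ has i.i.d. $\mathcal{CN}(0,1)$ entries; the vectors $\bm h_{e,k}$ are independent of each other and of $\Phi_E$. Put \[ \kappa=\frac{(1-\tau^2)P\|\hat{\bm h}_b\|^2}{\tau^2P+r_B^{\alpha}},\quad T=2^{R_S},\quad \omega=\frac{T-1}{\kappa},\quad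 \delta=\frac{2}{\alpha},\quad \beta=\pi\,\Gamma(1+\delta),\quad \theta=\frac{T-1}{T},\quad \varphi=\frac{\xi^{-1}-1}{N-1}, \] where $\xi\le 1$ is the power allocation ratio. The SINRs of Bob and of the $k$-th Eve are \[ \gamma_B=\xi\kappa,\qquad \gamma_k=\frac{\xi P|\bm h_{e,k}^{\mathrm T}\bm w|^2r_k^{-\alpha}}{(1-\xi)P\|\bm h_{e,k}^{\mathrm T}\bm G\|^2r_k^{-\alpha}/(N-1)+1}, \] and $C_B=\log_2(1+\gamma_B)$, $C_E=\log_2(1+\gamma_E)$ with $\gamma_E=\max_k\gamma_k$. If $\omega<\xi\le 1$, then the maximum $\gamma_E$ almost surely exists, and the secrecy outage probability $\mathcal{O}=\mathbb{P}\{C_E>C_B-R_S\}$ is \[ \mathcal{O}=1-\exp\!\left(-\beta\lambda_E\left(P\theta^{-1}\right)^{\delta}\mathcal{J}(\xi)\right),\qquad \mathcal{J}(\xi)=\left(\omega^{-1}-\xi^{-1}\right)^{-\delta}\left(1+\left(\xi\omega^{-1}-1\right)\theta\varphi\right)^{1-N}. \] -/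

import Mathlib

open MeasureTheory ProbabilityTheory
open scoped Matrix

noncomputable section

namespace SecrecyOutage

/-- The number of indices `k` (points of the configuration, counted with multiplicity) for which
the point `X k` lies in the set `B`. -/
def count {Ω E : Type*} (X : ℕ → Ω → E) (B : Set E) (s : Ω) : ℕ∞ :=
  {k : ℕ | X k s ∈ B}.encard

/-- The random points `X 0, X 1, …` enumerate a Poisson point process with intensity measure `L`:
the number of points in a measurable set of finite intensity is Poisson distributed with mean the
intensity of the set, and the numbers of points in disjoint sets are independent. -/
structure IsPoissonProcess {Ω E : Type*} [MeasurableSpace Ω] [MeasurableSpace E]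
    (X : ℕ → Ω → E) (L : Measure E) (μ : Measure Ω) : Prop where
  measurable : ∀ k, Measurable (X k)
  poisson : ∀ B : Set E, MeasurableSet B → L B ≠ ⊤ → ∀ n : ℕ,
    μ {s | count X B s = (n : ℕ∞)} = poissonMeasure (L B).toNNReal {n}
  indep : ∀ (m : ℕ) (B : Fin m → Set E), (∀ i, MeasurableSet (B i)) → (∀ i, L (B i) ≠ ⊤) →
    Pairwise (fun i j => Disjoint (B i) (B j)) → iIndepFun (fun i => count X (B i)) μ

/-- A homogeneous Poisson point process of density `lam` on the Euclidean plane. -/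
def IsHomogeneousPPP {Ω : Type*} [MeasurableSpace Ω]
    (X : ℕ → Ω → EuclideanSpace ℝ (Fin 2)) (lam : ℝ) (μ : Measure Ω) : Prop :=
  IsPoissonProcess X (ENNReal.ofReal lam • volume) μ

/-- The circularly symmetric complex Gaussian distribution `CN(0, 1)`: the real and imaginary parts
are independent centred Gaussians of variance `1 / 2`. -/
def complexGaussian : Measure ℂ :=
  ((gaussianReal 0 (1 / 2)).prod (gaussianReal 0 (1 / 2))).map
    (fun p : ℝ × ℝ => (⟨p.1, p.2⟩ : ℂ))

/-- The law of a vector in `ℂ ^ N` with i.i.d. `CN(0, 1)` entries (Rayleigh fading). -/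
def rayleigh (N : ℕ) : Measure (Fin N → ℂ) :=
  Measure.pi (fun _ => complexGaussian)

/-- The Euclidean norm of a complex vector. -/
def enorm2 {n : ℕ} (v : Fin n → ℂ) : ℝ := ‖WithLp.toLp 2 v‖

/-- The information beamformer: the entrywise conjugate of the estimated main channel, normalised. -/
def beam {N : ℕ} (hb : Fin N → ℂ) : Fin N → ℂ :=
  fun i => star (hb i) / (enorm2 hb : ℂ)

/-- `G` is an admissible artificial-noise matrix for the beamformer `w`: the columns of `[w G]`
are orthonormal. -/
def IsNoiseMatrix {N : ℕ} (w : Fin N → ℂ) (G : Matrix (Fin N) (Fin (N - 1)) ℂ) : Prop :=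
  (Matrix.fromCols (Matrix.replicateCol Unit w) G)ᴴ *
    Matrix.fromCols (Matrix.replicateCol Unit w) G = 1

/-- The accuracy parameter `κ` of the main channel estimate. -/
def kappa {N : ℕ} (P τ rB α : ℝ) (hb : Fin N → ℂ) : ℝ :=
  (1 - τ ^ 2) * P * enorm2 hb ^ 2 / (τ ^ 2 * P + rB ^ α)

/-- The SINR of Bob. -/
def sinrBob (ξ κ : ℝ) : ℝ := ξ * κ

/-- The SINR of an eavesdropper with small-scale fading vector `h` at distance `r`. -/
def sinrEve {N : ℕ} (P α ξ : ℝ) (w : Fin N → ℂ) (G : Matrix (Fin N) (Fin (N - 1)) ℂ)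
    (h : Fin N → ℂ) (r : ℝ) : ℝ :=
  ξ * P * ‖h ⬝ᵥ w‖ ^ 2 * r ^ (-α) /
    ((1 - ξ) * P * enorm2 (h ᵥ* G) ^ 2 * r ^ (-α) / ((N : ℝ) - 1) + 1)

/-- The capacity, in bits, of a channel with the given SINR. -/
def capacity (γ : ℝ) : ℝ := Real.logb 2 (1 + γ)

/-- The secrecy outage probability `ℙ (C_E > C_B - R_S)`, where `C_E` is the capacity at the SINR
`γ_E = max_k γ_k` and `C_B` is the capacity at the SINR `γB`. -/
def sop {Ω : Type*} [MeasurableSpace Ω] (μ : Measure Ω) (γ : ℕ → Ω → ℝ) (γB RS : ℝ) : ℝ :=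
  μ.real {s | capacity (⨆ k, γ k s) > capacity γB - RS}

/-- The function `J(ξ)` as a function of `N`, `δ`, `θ`, `ω` and `ξ`,
with `φ = (ξ⁻¹ - 1) / (N - 1)`. -/
def J (N : ℕ) (δ θ ω ξ : ℝ) : ℝ :=
  (ω⁻¹ - ξ⁻¹) ^ (-δ) *
    (1 + (ξ * ω⁻¹ - 1) * θ * ((ξ⁻¹ - 1) / ((N : ℝ) - 1))) ^ (1 - (N : ℤ))

end SecrecyOutage

end

/-! Outage means that some Eve has SINR above `t = (1 + γ_B) / T - 1 = θ (ξ / ω - 1)`, which is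
positive because `ω < ξ`. Its complement is a void event for the Poisson process of positions marked
by independent fading, so its probability is `exp (-Λ)`, with `Λ` the mean number of Eves above `t`.

For the void probability (`IsPoissonProcess.measure_forall_notMem`), fix the positions: the
probability that no mark is bad is a product, written as `exp (-∑ f (x_k))`, and averaging over
positions is the Laplace functional (`IsPoissonProcess.laplace`).

For `Λ`, orthonormality of `[w G]` makes the beam gain and the noise components i.i.d. complex
Gaussians (`map_vecMul_rayleigh`). The squared gain is exponential; averaging its tail over the
noise gives `exp (-c) (1 + b) ^ (1 - N)` (`rayleigh_gain_gt`), with `c` proportional to `r ^ α`.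
Integrating over the plane produces the Gamma factor.

The maximum exists because, by Campbell's formula and Borel–Cantelli, almost surely only finitely
many Eves exceed any given level `1 / (n + 1)`, while Eve `0` has positive SINR. -/

namespace SecrecyOutage

open Filter Topology
open scoped ENNReal NNReal

/-! ### The exponential `exp (-a)` with `a = ⊤` allowed -/

/-- The function `a ↦ exp (-a)` on the extended nonnegative reals. -/
noncomputable def nexp (a : ℝ≥0∞) : ℝ≥0∞ := EReal.exp (-(a : EReal))

lemma nexp_zero : nexp 0 = 1 := by simp [nexp]

lemma nexp_top : nexp ⊤ = 0 := by simp [nexp]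

lemma nexp_ofReal {x : ℝ} (hx : 0 ≤ x) : nexp (ENNReal.ofReal x) = ENNReal.ofReal (Real.exp (-x)) := by
  rw [nexp, EReal.coe_ennreal_ofReal, max_eq_left hx, ← EReal.coe_neg, EReal.exp_coe]

lemma nexp_add (a b : ℝ≥0∞) : nexp (a + b) = nexp a * nexp b := by
  rw [nexp, EReal.coe_ennreal_add, EReal.neg_add (Or.inl (by simp)) (Or.inr (by simp)),
    sub_eq_add_neg, EReal.exp_add, nexp, nexp]

lemma nexp_sum {ι : Type*} (s : Finset ι) (a : ι → ℝ≥0∞) :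
    nexp (∑ i ∈ s, a i) = ∏ i ∈ s, nexp (a i) := by
  classical
  induction s using Finset.induction_on with
  | empty => simp [nexp_zero]
  | insert i s hi ih => rw [Finset.sum_insert hi, Finset.prod_insert hi, nexp_add, ih]

lemma nexp_antitone : Antitone nexp := fun _ _ hab =>
  EReal.exp_monotone (EReal.neg_le_neg_iff.2 (EReal.coe_ennreal_le_coe_ennreal_iff.2 hab))

lemma nexp_le_one (a : ℝ≥0∞) : nexp a ≤ 1 := nexp_zero ▸ nexp_antitone (zero_le (a := a))

lemma continuous_nexp : Continuous nexp :=
  ENNReal.continuous_exp.comp (continuous_neg.comp continuous_coe_ennreal_ereal)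

lemma measurable_nexp : Measurable nexp := continuous_nexp.measurable

lemma nexp_natCast_mul (n : ℕ) (a : ℝ≥0∞) : nexp (n * a) = nexp a ^ n := by
  have := nexp_sum (Finset.range n) (fun _ => a)
  simpa using this

/-- Lets products of probabilities be handled as sums of exponents; `⊤` covers `p = 0`, where
`Real.log` has the wrong default value. -/
lemma nexp_ite_neg_log {p : ℝ≥0∞} (hp : p ≤ 1) :
    nexp (if p = 0 then ⊤ else ENNReal.ofReal (-Real.log p.toReal)) = p := by
  split_ifs with h
  · rw [nexp_top, h]
  · have hpt : p ≠ ⊤ := ne_top_of_le_ne_top ENNReal.one_ne_top hp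
    have h1 : p.toReal ≤ 1 := by simpa using ENNReal.toReal_mono ENNReal.one_ne_top hp
    have h0 : 0 < p.toReal := ENNReal.toReal_pos h hpt
    rw [nexp_ofReal (by simpa using Real.log_nonpos h0.le h1), neg_neg, Real.exp_log h0,
      ENNReal.ofReal_toReal hpt]

/-! ### Counts, Laplace functional and intensity of a Poisson process -/

section Count

variable {Ω E : Type*} [MeasurableSpace E]

/-- The random counting measure of the points `X 0, X 1, …`. -/
noncomputable def pointMeasure (X : ℕ → Ω → E) (s : Ω) : Measure E :=
  Measure.sum fun k => Measure.dirac (X k s)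

lemma lintegral_pointMeasure (X : ℕ → Ω → E) (s : Ω) {f : E → ℝ≥0∞} (hf : Measurable f) :
    ∫⁻ x, f x ∂pointMeasure X s = ∑' k, f (X k s) := by
  rw [pointMeasure, lintegral_sum_measure]
  simp [lintegral_dirac' _ hf]

lemma pointMeasure_apply (X : ℕ → Ω → E) (s : Ω) {B : Set E} (hB : MeasurableSet B) :
    pointMeasure X s B = (count X B s : ℝ≥0∞) := by
  rw [← lintegral_indicator_one hB, lintegral_pointMeasure _ _ (measurable_one.indicator hB),
    count, ← ENNReal.tsum_set_one, tsum_subtype {k | X k s ∈ B} (fun _ => (1 : ℝ≥0∞))]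
  rfl

lemma count_eq_tsum (X : ℕ → Ω → E) (s : Ω) {B : Set E} (hB : MeasurableSet B) :
    (count X B s : ℝ≥0∞) = ∑' k, B.indicator 1 (X k s) := by
  rw [← pointMeasure_apply X s hB, ← lintegral_indicator_one hB,
    lintegral_pointMeasure _ _ (measurable_one.indicator hB)]

variable [MeasurableSpace Ω]

lemma measurable_count {X : ℕ → Ω → E} (hX : ∀ k, Measurable (X k)) {B : Set E}
    (hB : MeasurableSet B) : Measurable (count X B) := by
  have h : Measurable fun s => (count X B s : ℝ≥0∞) := by
    simp_rw [count_eq_tsum X _ hB]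
    exact Measurable.tsum fun k => (measurable_one.indicator hB).comp (hX k)
  refine measurable_to_countable' fun n => ?_
  have : count X B ⁻¹' {n} = (fun s => (count X B s : ℝ≥0∞)) ⁻¹' {(n : ℝ≥0∞)} := by
    ext s; simp
  rw [this]
  exact h (measurableSet_singleton _)

/-- The Poisson masses at finite values already sum to one, so the count has no mass at `⊤` and its
law is determined. -/
lemma IsPoissonProcess.lintegral_count {X : ℕ → Ω → E} {L : Measure E} {μ : Measure Ω}
    [IsProbabilityMeasure μ] (hX : IsPoissonProcess X L μ) {B : Set E} (hB : MeasurableSet B)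
    (hLB : L B ≠ ⊤) (g : ℕ∞ → ℝ≥0∞) :
    ∫⁻ s, g (count X B s) ∂μ = ∑' n : ℕ, g n * poissonMeasure (L B).toNNReal {n} := by
  have hm := measurable_count hX.measurable hB
  have hmap : μ.map (count X B) =
      (poissonMeasure (L B).toNNReal).map (fun n : ℕ => (n : ℕ∞)) := by
    have hfin : ∀ n : ℕ, μ.map (count X B) {(n : ℕ∞)} =
        (poissonMeasure (L B).toNNReal).map (fun n : ℕ => (n : ℕ∞)) {(n : ℕ∞)} := by
      intro n
      rw [Measure.map_apply hm (measurableSet_singleton _),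
        Measure.map_apply Measurable.of_discrete (measurableSet_singleton _)]
      have : (fun n : ℕ => (n : ℕ∞)) ⁻¹' {(n : ℕ∞)} = {n} := by ext; simp
      rw [this]
      exact hX.poisson B hB hLB n
    have hU : (Set.range fun n : ℕ => (n : ℕ∞)) = {⊤}ᶜ := by
      ext x; induction x <;> simp
    have hrange : ∀ ν : Measure ℕ∞, ν (Set.range fun n : ℕ => (n : ℕ∞)) = ∑' n : ℕ, ν {(n : ℕ∞)} := by
      intro ν
      rw [← Set.iUnion_singleton_eq_range, measure_iUnion]
      · intro i j hij; simpa using hij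
      · intro i; exact measurableSet_singleton _
    have : IsProbabilityMeasure (μ.map (count X B)) := Measure.isProbabilityMeasure_map hm.aemeasurable
    have : IsProbabilityMeasure ((poissonMeasure (L B).toNNReal).map (fun n : ℕ => (n : ℕ∞))) :=
      Measure.isProbabilityMeasure_map Measurable.of_discrete.aemeasurable
    refine Measure.ext_of_singleton fun x => ?_
    induction x with
    | coe n => exact hfin n
    | top =>
      have h1 : ∀ ν : Measure ℕ∞, IsProbabilityMeasure ν → ν {⊤} = 1 - ∑' n : ℕ, ν {(n : ℕ∞)} := by
        intro ν _
        rw [← hrange, ← prob_compl_eq_one_sub (Set.countable_range _).measurableSet, hU, compl_compl]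
      rw [h1 _ inferInstance, h1 _ inferInstance]
      simp_rw [hfin]
  rw [← lintegral_map (f := g) Measurable.of_discrete hm, hmap,
    lintegral_map Measurable.of_discrete Measurable.of_discrete, lintegral_countable']

lemma IsPoissonProcess.lintegral_count_eq {X : ℕ → Ω → E} {L : Measure E} {μ : Measure Ω}
    [IsProbabilityMeasure μ] (hX : IsPoissonProcess X L μ) {B : Set E} (hB : MeasurableSet B)
    (hLB : L B ≠ ⊤) : ∫⁻ s, (count X B s : ℝ≥0∞) ∂μ = L B := by
  rw [hX.lintegral_count hB hLB (fun n => (n : ℝ≥0∞))]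
  set r := (L B).toNNReal
  have hs : HasSum (fun n : ℕ => (n : ℝ) * (Real.exp (-r) * (r : ℝ) ^ n / n.factorial)) r := by
    -- The term `n = 0` vanishes; after the shift, `(n + 1) / (n + 1)! = 1 / n!` leaves `r` times
    -- the total Poisson mass.
    rw [← hasSum_nat_add_iff' 1]
    simp only [Finset.range_one, Finset.sum_singleton, Nat.cast_zero, zero_mul, sub_zero]
    have := (hasSum_one_poissonMeasure r).mul_left (r : ℝ)
    rw [mul_one] at this
    refine this.congr_fun ?_
    intro n
    rw [Nat.factorial_succ]
    push_cast
    field_simp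
    ring
  simp_rw [poissonMeasure_singleton]
  have h0 : ∀ n : ℕ, 0 ≤ (n : ℝ) * (Real.exp (-r) * (r : ℝ) ^ n / n.factorial) := fun n => by positivity
  have h1 := ENNReal.ofReal_tsum_of_nonneg h0 hs.summable
  rw [hs.tsum_eq, ENNReal.ofReal_coe_nnreal, ENNReal.coe_toNNReal hLB] at h1
  rw [h1]
  congr with n
  rw [ENNReal.ofReal_mul (by positivity)]
  simp

/-- This is the Poisson generating function `exp (-(1 - q) r)` at `q = exp (-a)`, with `q = 0` when
`a = ⊤`. -/
lemma IsPoissonProcess.lintegral_nexp_count {X : ℕ → Ω → E} {L : Measure E} {μ : Measure Ω}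
    [IsProbabilityMeasure μ] (hX : IsPoissonProcess X L μ) {B : Set E} (hB : MeasurableSet B)
    (hLB : L B ≠ ⊤) (a : ℝ≥0∞) :
    ∫⁻ s, nexp (a * count X B s) ∂μ = nexp ((1 - nexp a) * L B) := by
  rw [hX.lintegral_count hB hLB (fun n => nexp (a * n))]
  set r := (L B).toNNReal with hr
  have hat : nexp a ≠ ⊤ := ne_top_of_le_ne_top ENNReal.one_ne_top (nexp_le_one a)
  obtain ⟨q, hq⟩ : ∃ q : ℝ≥0, nexp a = q := ⟨(nexp a).toNNReal, (ENNReal.coe_toNNReal hat).symm⟩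
  have hq1 : q ≤ 1 := by
    have := nexp_le_one a
    rw [hq] at this
    exact_mod_cast this
  have hs : HasSum (fun n : ℕ => (q : ℝ) ^ n * (Real.exp (-r) * (r : ℝ) ^ n / n.factorial))
      (Real.exp (-((1 - q) * r))) := by
    have h1 := (NormedSpace.expSeries_div_hasSum_exp (𝔸 := ℝ) (q * r)).mul_left (Real.exp (-r))
    rw [← Real.exp_eq_exp_ℝ, ← Real.exp_add] at h1
    have h2 : -((1 - (q : ℝ)) * r) = -r + q * r := by ring
    rw [h2]
    refine h1.congr_fun fun n => ?_
    rw [mul_pow]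
    ring
  have h0 : ∀ n : ℕ, 0 ≤ (q : ℝ) ^ n * (Real.exp (-r) * (r : ℝ) ^ n / n.factorial) :=
    fun n => by positivity
  have hrhs : (1 - nexp a) * L B = ENNReal.ofReal ((1 - q) * r) := by
    rw [ENNReal.ofReal_mul (by simpa using hq1), ENNReal.ofReal_coe_nnreal, hr,
      ENNReal.coe_toNNReal hLB, hq]
    congr 1
  have hpos : 0 ≤ (1 - (q : ℝ)) * r := mul_nonneg (by simpa using hq1) r.2
  rw [hrhs, nexp_ofReal hpos, ← hs.tsum_eq,
    ENNReal.ofReal_tsum_of_nonneg h0 hs.summable]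
  congr with n
  rw [ENNReal.ofReal_mul (by positivity), poissonMeasure_singleton]
  congr 1
  rw [ENat.toENNReal_coe, mul_comm, nexp_natCast_mul, hq]
  simp [ENNReal.ofReal_pow]

/-- The sum over points is a combination of counts of disjoint level sets, which are independent, so
the expectation factors. -/
lemma IsPoissonProcess.laplace_simpleFunc {X : ℕ → Ω → E} {L : Measure E} {μ : Measure Ω}
    [IsProbabilityMeasure μ] (hX : IsPoissonProcess X L μ) (f : SimpleFunc E ℝ≥0∞)
    (hf : f.FinMeasSupp L) :
    ∫⁻ s, nexp (∑' k, f (X k s)) ∂μ = nexp (∫⁻ x, (1 - nexp (f x)) ∂L) := by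
  classical
  -- The value `0` contributes nothing, and its level set may have infinite intensity.
  set R := f.range.filter (· ≠ 0)
  have hL : ∀ x ∈ R, L (f ⁻¹' {x}) ≠ ⊤ := by
    intro x hx
    exact (hf.meas_preimage_singleton_ne_zero (Finset.mem_filter.1 hx).2).ne
  have h1 : ∀ s, ∑' k, f (X k s) = ∑ x ∈ R, x * count X (f ⁻¹' {x}) s := by
    intro s
    rw [← lintegral_pointMeasure X s f.measurable, SimpleFunc.lintegral_eq_lintegral,
      SimpleFunc.lintegral, Finset.sum_filter_of_ne]
    · refine Finset.sum_congr rfl fun x _ => ?_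
      rw [pointMeasure_apply X s (f.measurableSet_preimage _)]
    · rintro x _ h rfl; simp at h
  have h2 : ∫⁻ x, (1 - nexp (f x)) ∂L = ∑ x ∈ R, (1 - nexp x) * L (f ⁻¹' {x}) := by
    have : ∀ x, 1 - nexp (f x) = (f.map fun a => 1 - nexp a) x := fun x => rfl
    simp_rw [this]
    rw [SimpleFunc.lintegral_eq_lintegral, SimpleFunc.map_lintegral, Finset.sum_filter_of_ne]
    rintro x _ h rfl; simp [nexp_zero] at h
  have hind : iIndepFun (fun x : R => count X (f ⁻¹' {(x : ℝ≥0∞)})) μ := by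
    have := hX.indep R.card (fun i => f ⁻¹' {((R.equivFin.symm i : R) : ℝ≥0∞)})
      (fun i => f.measurableSet_preimage _) (fun i => hL _ (R.equivFin.symm i).2) ?_
    · have h3 := this.precomp R.equivFin.injective
      simpa using h3
    · intro i j hij
      refine Disjoint.preimage f ?_
      simpa [Subtype.ext_iff] using fun h => hij (R.equivFin.symm.injective (Subtype.ext h))
  have hind' := hind.comp (fun (x : R) (n : ℕ∞) => nexp ((x : ℝ≥0∞) * n))
    (fun _ => Measurable.of_discrete)
  simp_rw [h1, nexp_sum, h2]
  rw [nexp_sum]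
  have h4 := lintegral_prod_eq_prod_lintegral_of_indepFun Finset.univ _ hind' (fun x =>
    Measurable.of_discrete.comp (measurable_count hX.measurable (f.measurableSet_preimage _)))
  simp only [Function.comp_apply] at h4
  simp_rw [← Finset.prod_coe_sort R]
  rw [h4]
  refine Finset.prod_congr rfl fun x _ => ?_
  exact hX.lintegral_nexp_count (f.measurableSet_preimage _) (hL x x.2) x

/-- The Laplace functional of a Poisson process. -/
theorem IsPoissonProcess.laplace {X : ℕ → Ω → E} {L : Measure E} [SigmaFinite L] {μ : Measure Ω}
    [IsProbabilityMeasure μ] (hX : IsPoissonProcess X L μ) {f : E → ℝ≥0∞} (hf : Measurable f) :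
    ∫⁻ s, nexp (∑' k, f (X k s)) ∂μ = nexp (∫⁻ x, (1 - nexp (f x)) ∂L) := by
  -- Truncation to sets of finite intensity brings the simple-function case into play while keeping
  -- monotone convergence to `f`.
  set φ : ℕ → SimpleFunc E ℝ≥0∞ := fun n => (SimpleFunc.eapprox f n).restrict (spanningSets L n)
  have hφ : ∀ n x, φ n x = (spanningSets L n).indicator (SimpleFunc.eapprox f n) x := fun n x =>
    SimpleFunc.restrict_apply _ (measurableSet_spanningSets L n) x
  have hmono : Monotone fun n x => φ n x := by
    intro m n hmn x
    simp only [hφ]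
    exact (Set.indicator_le_indicator (SimpleFunc.monotone_eapprox f hmn x)).trans
      (Set.indicator_le_indicator_of_subset (monotone_spanningSets L hmn) (fun _ => zero_le) x)
  have htend : ∀ x, Tendsto (fun n => φ n x) atTop (𝓝 (f x)) := by
    intro x
    have h1 : Tendsto (fun n => SimpleFunc.eapprox f n x) atTop (𝓝 (f x)) := by
      rw [← SimpleFunc.iSup_eapprox_apply hf x]
      exact tendsto_atTop_iSup fun m n hmn => SimpleFunc.monotone_eapprox f hmn x
    refine h1.congr' ?_
    filter_upwards [eventually_ge_atTop (spanningSetsIndex L x)] with n hn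
    rw [hφ, Set.indicator_of_mem (mem_spanningSets_of_index_le L x hn)]
  have hfin : ∀ n, (φ n).FinMeasSupp L := by
    intro n
    rw [SimpleFunc.finMeasSupp_iff_support]
    refine (measure_mono ?_).trans_lt (measure_spanningSets_lt_top L n)
    intro x hx
    by_contra h
    exact hx (by rw [hφ, Set.indicator_of_notMem h])
  have hsum : ∀ s, Tendsto (fun n => ∑' k, φ n (X k s)) atTop (𝓝 (∑' k, f (X k s))) := by
    intro s
    simp_rw [← lintegral_pointMeasure X s hf, ← lintegral_pointMeasure X s (φ _).measurable]
    exact lintegral_tendsto_of_tendsto_of_monotone (fun n => (φ n).measurable.aemeasurable)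
      (ae_of_all _ fun x m n hmn => hmono hmn x) (ae_of_all _ htend)
  have hlhs : Tendsto (fun n => ∫⁻ s, nexp (∑' k, φ n (X k s)) ∂μ) atTop
      (𝓝 (∫⁻ s, nexp (∑' k, f (X k s)) ∂μ)) := by
    refine tendsto_lintegral_of_dominated_convergence (fun _ => 1) (fun n => ?_) (fun n => ?_)
      (by simp) ?_
    · exact measurable_nexp.comp (Measurable.tsum fun k =>
        (φ n).measurable.comp (hX.measurable k))
    · exact ae_of_all _ fun s => nexp_le_one _
    · exact ae_of_all _ fun s => (continuous_nexp.tendsto _).comp (hsum s)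
  have hrhs : Tendsto (fun n => nexp (∫⁻ x, (1 - nexp (φ n x)) ∂L)) atTop
      (𝓝 (nexp (∫⁻ x, (1 - nexp (f x)) ∂L))) := by
    -- `L` may be infinite, so the constant bound `1` used on the other side is replaced by
    -- monotonicity.
    refine (continuous_nexp.tendsto _).comp (lintegral_tendsto_of_tendsto_of_monotone
      (fun n => (measurable_const.sub (measurable_nexp.comp (φ n).measurable)).aemeasurable)
      (ae_of_all _ fun x m n hmn => tsub_le_tsub_left (nexp_antitone (hmono hmn x)) 1)
      (ae_of_all _ fun x => ?_))
    exact ((ENNReal.continuous_sub_left ENNReal.one_ne_top).comp continuous_nexp).continuousAt.tendsto.comp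
      (htend x)
  refine tendsto_nhds_unique hlhs (hrhs.congr fun n => (hX.laplace_simpleFunc _ (hfin n)).symm)

/-- The sum of the laws of the points of a Poisson process is its intensity measure. -/
theorem IsPoissonProcess.sum_map_eq {X : ℕ → Ω → E} {L : Measure E} [SigmaFinite L] {μ : Measure Ω}
    [IsProbabilityMeasure μ] (hX : IsPoissonProcess X L μ) :
    Measure.sum (fun k => μ.map (X k)) = L := by
  have h1 : ∀ B, MeasurableSet B → L B ≠ ⊤ → Measure.sum (fun k => μ.map (X k)) B = L B := by
    intro B hB hLB
    rw [← hX.lintegral_count_eq hB hLB, Measure.sum_apply _ hB]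
    simp_rw [count_eq_tsum X _ hB]
    rw [lintegral_tsum (f := fun k s => B.indicator 1 (X k s)) fun k =>
      ((measurable_one.indicator hB).comp (hX.measurable k)).aemeasurable]
    congr with k
    rw [← lintegral_map (measurable_one.indicator hB) (hX.measurable k), lintegral_indicator_one hB]
  have h2 : ∀ (ν : Measure E) B, ν B = ⨆ n, ν (B ∩ spanningSets L n) := by
    intro ν B
    rw [← Monotone.measure_iUnion fun m n hmn =>
      Set.inter_subset_inter_right _ (monotone_spanningSets L hmn),
      ← Set.inter_iUnion, iUnion_spanningSets, Set.inter_univ]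
  ext B hB
  rw [h2, h2 L]
  congr with n
  exact h1 _ (hB.inter (measurableSet_spanningSets L n))
    (ne_top_of_le_ne_top (measure_spanningSets_lt_top L n).ne (measure_mono Set.inter_subset_right))

end Count

/-! ### Independent marking -/

section Marking

variable {Ω E M : Type*} [MeasurableSpace Ω] [MeasurableSpace E] [MeasurableSpace M]

/-- Independence gives the finite intersections; continuity from above passes to the limit. -/
lemma measure_forall_mem_eq_nexp_tsum {μ : Measure Ω} [IsProbabilityMeasure μ] {ρ : Measure M}
    {h : ℕ → Ω → M} (hlaw : ∀ k, HasLaw (h k) ρ μ) (hm : ∀ k, Measurable (h k))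
    (hind : iIndepFun h μ) {C : ℕ → Set M} (hC : ∀ k, MeasurableSet (C k)) {f : ℕ → ℝ≥0∞}
    (hf : ∀ k, nexp (f k) = ρ (C k)) :
    μ {s | ∀ k, h k s ∈ C k} = nexp (∑' k, f k) := by
  have h1 : ∀ n, μ (⋂ k ∈ Finset.range n, h k ⁻¹' C k) = nexp (∑ k ∈ Finset.range n, f k) := by
    intro n
    rw [hind.measure_inter_preimage_eq_mul _ fun k _ => hC k, nexp_sum]
    refine Finset.prod_congr rfl fun k _ => ?_
    rw [hf, ← (hlaw k).map_eq, Measure.map_apply (hm k) (hC k)]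
  have h2 : Tendsto (fun n => nexp (∑ k ∈ Finset.range n, f k)) atTop (𝓝 (nexp (∑' k, f k))) :=
    (continuous_nexp.tendsto _).comp ENNReal.summable.hasSum.tendsto_sum_nat
  have h3 : Tendsto (fun n => μ (⋂ k ∈ Finset.range n, h k ⁻¹' C k)) atTop
      (𝓝 (μ (⋂ n, ⋂ k ∈ Finset.range n, h k ⁻¹' C k))) := by
    refine tendsto_measure_iInter_atTop (fun n => ?_) (fun m n hmn => ?_) ⟨0, by simp⟩
    · exact (Finset.measurableSet_biInter _ fun k _ => hm k (hC k)).nullMeasurableSet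
    · exact Set.biInter_subset_biInter_left (Finset.range_mono hmn)
  have h4 : {s | ∀ k, h k s ∈ C k} = ⋂ n, ⋂ k ∈ Finset.range n, h k ⁻¹' C k := by
    ext s
    simp only [Set.mem_ofPred_eq, Set.mem_iInter, Finset.mem_range, Set.mem_preimage]
    exact ⟨fun hs _ k _ => hs k, fun hs k => hs (k + 1) k k.lt_succ_self⟩
  rw [h4]
  exact tendsto_nhds_unique h3 (h2.congr fun n => (h1 n).symm)

/-- The void probabilities of an independently marked Poisson process. -/
theorem IsPoissonProcess.measure_forall_notMem {X : ℕ → Ω → E} {L : Measure E} [SigmaFinite L]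
    {μ : Measure Ω} [IsProbabilityMeasure μ] (hX : IsPoissonProcess X L μ) {ρ : Measure M}
    [IsProbabilityMeasure ρ] {h : ℕ → Ω → M} (hlaw : ∀ k, HasLaw (h k) ρ μ)
    (hm : ∀ k, Measurable (h k)) (hind : iIndepFun h μ)
    (hXh : IndepFun (fun s k => X k s) (fun s k => h k s) μ)
    {A : Set (E × M)} (hA : MeasurableSet A) :
    μ {s | ∀ k, (X k s, h k s) ∉ A} = nexp (∫⁻ x, ρ (Prod.mk x ⁻¹' A) ∂L) := by
  have hXm : Measurable fun s k => X k s := measurable_pi_lambda _ hX.measurable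
  have hhm : Measurable fun s k => h k s := measurable_pi_lambda _ hm
  have hmeas : Measurable fun x => ρ (Prod.mk x ⁻¹' Aᶜ) := measurable_measure_prodMk_left hA.compl
  -- Minus the logarithm of the probability that the mark at `x` avoids `A`, so that `1 - nexp (f
  -- x)` is the probability of hitting it.
  set f : E → ℝ≥0∞ := fun x => if ρ (Prod.mk x ⁻¹' Aᶜ) = 0 then ⊤ else
    ENNReal.ofReal (-Real.log (ρ (Prod.mk x ⁻¹' Aᶜ)).toReal)
  have hf : Measurable f := Measurable.ite (hmeas (measurableSet_singleton 0)) measurable_const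
    hmeas.ennreal_toReal.log.neg.ennreal_ofReal
  have hfe : ∀ x, nexp (f x) = ρ (Prod.mk x ⁻¹' Aᶜ) := fun x => nexp_ite_neg_log prob_le_one
  have hfe' : ∀ x, 1 - nexp (f x) = ρ (Prod.mk x ⁻¹' A) := fun x => by
    rw [hfe, ← prob_compl_eq_one_sub (measurable_prodMk_left hA.compl), Set.preimage_compl,
      compl_compl]
  simp_rw [← hfe']
  rw [← hX.laplace hf]
  set S : Set ((ℕ → E) × (ℕ → M)) := {p | ∀ k, (p.1 k, p.2 k) ∈ Aᶜ}
  have hS : MeasurableSet S := by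
    simp only [S, Set.ofPred_forall]
    exact MeasurableSet.iInter fun k => (((measurable_pi_apply k).comp measurable_fst).prodMk
      ((measurable_pi_apply k).comp measurable_snd)) hA.compl
  have h1 : {s | ∀ k, (X k s, h k s) ∉ A} = (fun s => (fun k => X k s, fun k => h k s)) ⁻¹' S := rfl
  -- Positions and marks have a product joint law, so Fubini allows the positions to be frozen.
  rw [h1, ← Measure.map_apply (hXm.prodMk hhm) hS,
    (indepFun_iff_map_prod_eq_prod_map_map hXm.aemeasurable hhm.aemeasurable).1 hXh]
  have : IsProbabilityMeasure (μ.map fun s k => h k s) :=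
    Measure.isProbabilityMeasure_map hhm.aemeasurable
  rw [Measure.prod_apply hS, lintegral_map (measurable_measure_prodMk_left hS) hXm]
  refine lintegral_congr fun s => ?_
  rw [Measure.map_apply hhm (measurable_prodMk_left hS)]
  exact measure_forall_mem_eq_nexp_tsum hlaw hm hind
    (fun k => measurable_prodMk_left hA.compl) (fun k => hfe (X k s))

/-- Campbell's formula for an independently marked Poisson process. -/
theorem IsPoissonProcess.tsum_measure_mem {X : ℕ → Ω → E} {L : Measure E} [SigmaFinite L]
    {μ : Measure Ω} [IsProbabilityMeasure μ] (hX : IsPoissonProcess X L μ) {ρ : Measure M}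
    [IsProbabilityMeasure ρ] {h : ℕ → Ω → M} (hlaw : ∀ k, HasLaw (h k) ρ μ)
    (hXh : IndepFun (fun s k => X k s) (fun s k => h k s) μ)
    {A : Set (E × M)} (hA : MeasurableSet A) :
    ∑' k, μ {s | (X k s, h k s) ∈ A} = ∫⁻ x, ρ (Prod.mk x ⁻¹' A) ∂L := by
  have h1 : ∀ k, μ {s | (X k s, h k s) ∈ A} = ∫⁻ x, ρ (Prod.mk x ⁻¹' A) ∂μ.map (X k) := by
    intro k
    have hk : IndepFun (X k) (h k) μ :=
      hXh.comp (measurable_pi_apply k) (measurable_pi_apply k)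
    have hXk := (hX.measurable k).aemeasurable (μ := μ)
    have hhk := (hlaw k).aemeasurable
    have : {s | (X k s, h k s) ∈ A} = (fun s => (X k s, h k s)) ⁻¹' A := rfl
    rw [this, ← Measure.map_apply_of_aemeasurable (hXk.prodMk hhk) hA,
      (indepFun_iff_map_prod_eq_prod_map_map hXk hhk).1 hk, (hlaw k).map_eq, Measure.prod_apply hA]
  simp_rw [h1]
  rw [← lintegral_sum_measure, hX.sum_map_eq]

end Marking

/-! ### Complex Gaussian vectors and the gain tail -/

section Gaussian

instance : IsProbabilityMeasure complexGaussian :=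
  Measure.isProbabilityMeasure_map Complex.measurableEquivRealProd.symm.measurable.aemeasurable

instance (N : ℕ) : IsProbabilityMeasure (rayleigh N) := by
  unfold rayleigh; infer_instance

lemma charFunDual_gaussianReal_zero (v : ℝ≥0) (L : StrongDual ℝ ℝ) :
    charFunDual (gaussianReal 0 v) L = Complex.exp (-(v * L 1 ^ 2 / 2)) := by
  have h1 : charFunDual (gaussianReal 0 v) L = charFun (gaussianReal 0 v) (L 1) := by
    rw [charFunDual_apply, charFun_apply_real]
    refine integral_congr_ae (ae_of_all _ fun x => ?_)
    have : L x = L 1 * x := by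
      have := L.map_smul x 1
      simp only [smul_eq_mul, mul_one] at this
      rw [this, mul_comm]
    simp only [this]
    push_cast
    rfl
  rw [h1, charFun_gaussianReal]
  simp

lemma charFunDual_complexGaussian (L : StrongDual ℝ ℂ) :
    charFunDual complexGaussian L = Complex.exp (-((L 1 ^ 2 + L Complex.I ^ 2 : ℝ) / 4)) := by
  have h1 : complexGaussian = ((gaussianReal 0 (1 / 2)).prod (gaussianReal 0 (1 / 2))).map
      (Complex.equivRealProdCLM.symm : ℝ × ℝ →L[ℝ] ℂ) := by
    rw [complexGaussian]
    congr
  have e1 : Complex.equivRealProdCLM.symm ((1 : ℝ), (0 : ℝ)) = 1 := by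
    apply Complex.ext <;> simp
  have e2 : Complex.equivRealProdCLM.symm ((0 : ℝ), (1 : ℝ)) = Complex.I := by
    apply Complex.ext <;> simp
  rw [h1, charFunDual_map, charFunDual_prod, charFunDual_gaussianReal_zero,
    charFunDual_gaussianReal_zero, ← Complex.exp_add]
  simp only [ContinuousLinearMap.comp_apply, ContinuousLinearMap.inl_apply,
    ContinuousLinearMap.inr_apply, ContinuousLinearEquiv.coe_coe, e1, e2]
  congr 1
  push_cast
  ring

/-- Only the Euclidean norm of the vector `a` representing `L` enters; this is the source of unitary
invariance. -/
lemma charFunDual_pi_complexGaussian {ι : Type*} [Fintype ι] [DecidableEq ι]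
    (L : StrongDual ℝ (ι → ℂ)) (a : ι → ℂ) (hL : ∀ i c, L (Pi.single i c) = (c * a i).re) :
    charFunDual (Measure.pi fun _ : ι => complexGaussian) L =
      Complex.exp (-((∑ i, ‖a i‖ ^ 2 : ℝ) / 4)) := by
  rw [charFunDual_pi]
  simp_rw [charFunDual_complexGaussian]
  rw [← Complex.exp_sum]
  congr 1
  push_cast
  rw [Finset.sum_div, ← Finset.sum_neg_distrib]
  refine Finset.sum_congr rfl fun i _ => ?_
  have h1 : (⇑L ∘ ⇑(ContinuousLinearMap.single ℝ (fun _ : ι => ℂ) i)) 1 = (a i).re := by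
    simp [hL]
  have h2 : (⇑L ∘ ⇑(ContinuousLinearMap.single ℝ (fun _ : ι => ℂ) i)) Complex.I = -(a i).im := by
    simp [hL]
  rw [h1, h2]
  have h3 : ‖a i‖ ^ 2 = (a i).re ^ 2 + (-(a i).im) ^ 2 := by
    rw [Complex.sq_norm, Complex.normSq_apply]; ring
  rw [← Complex.ofReal_pow ‖a i‖, h3]
  push_cast
  ring

lemma sum_norm_sq_mulVec {m n : Type*} [Fintype m] [Fintype n] [DecidableEq n]
    {Q : Matrix m n ℂ} (hQ : Qᴴ * Q = 1) (a : n → ℂ) :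
    ∑ i, ‖(Q *ᵥ a) i‖ ^ 2 = ∑ j, ‖a j‖ ^ 2 := by
  have h2 : star (Q *ᵥ a) ⬝ᵥ (Q *ᵥ a) = star a ⬝ᵥ a := by
    rw [Matrix.star_mulVec, ← Matrix.dotProduct_mulVec, Matrix.mulVec_mulVec, hQ,
      Matrix.one_mulVec]
  have h3 : ((∑ i, ‖(Q *ᵥ a) i‖ ^ 2 : ℝ) : ℂ) = ((∑ j, ‖a j‖ ^ 2 : ℝ) : ℂ) := by
    rw [Complex.ofReal_sum, Complex.ofReal_sum]
    simpa [dotProduct, Complex.conj_mul'] using h2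
  exact_mod_cast h3

/-- A Gaussian vector with i.i.d. entries is mapped to one by a matrix with orthonormal columns. -/
lemma map_vecMul_rayleigh {N : ℕ} {ι : Type*} [Fintype ι] [DecidableEq ι]
    {Q : Matrix (Fin N) ι ℂ} (hQ : Qᴴ * Q = 1) :
    (rayleigh N).map (fun h => h ᵥ* Q) = Measure.pi fun _ : ι => complexGaussian := by
  set T : (Fin N → ℂ) →L[ℝ] (ι → ℂ) :=
    (LinearMap.toContinuousLinearMap ((Matrix.vecMulLinear Q))).restrictScalars ℝ
  have hT : ∀ h, T h = h ᵥ* Q := fun h => rfl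
  have : IsProbabilityMeasure ((rayleigh N).map T) :=
    Measure.isProbabilityMeasure_map T.continuous.measurable.aemeasurable
  change (rayleigh N).map T = _
  apply Measure.ext_of_charFunDual
  funext L
  rw [charFunDual_map]
  -- Chosen so that the real-linear `L` becomes `v ↦ Re (∑ v j * a j)`; its pullback along `Q` is
  -- then represented by `Q *ᵥ a`.
  set a : ι → ℂ := fun j => (L (Pi.single j 1) : ℂ) - L (Pi.single j Complex.I) * Complex.I
  have ha : ∀ j c, L (Pi.single j c) = (c * a j).re := by
    intro j c
    have h1 : (Pi.single j c : ι → ℂ) =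
        c.re • (Pi.single j 1 : ι → ℂ) + c.im • (Pi.single j Complex.I : ι → ℂ) := by
      rw [← Pi.single_smul, ← Pi.single_smul, ← Pi.single_add]
      congr 1
      apply Complex.ext <;> simp
    rw [h1, map_add, map_smul, map_smul]
    simp [a]
  have hL : ∀ v, L v = (∑ j, v j * a j).re := by
    intro v
    conv_lhs => rw [← Finset.univ_sum_single v]
    rw [map_sum, Complex.re_sum]
    exact Finset.sum_congr rfl fun j _ => ha j _
  rw [rayleigh, charFunDual_pi_complexGaussian L a ha,
    charFunDual_pi_complexGaussian _ (Q *ᵥ a), sum_norm_sq_mulVec hQ]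
  intro i c
  rw [ContinuousLinearMap.comp_apply, hT, hL, Matrix.single_vecMul]
  simp only [Matrix.mulVec, dotProduct, Finset.mul_sum, Pi.smul_apply, Matrix.row]
  congr 1
  refine Finset.sum_congr rfl fun j _ => ?_
  simp [mul_assoc]

/-- Serves both the tail of `‖z‖ ^ 2` (`b = 1`) and its Laplace transform (`a = 0`). -/
lemma lintegral_Ioi_mul_exp_neg_mul_sq {a b : ℝ} (ha : 0 ≤ a) (hb : 0 < b) :
    ∫⁻ r in Set.Ioi a, ENNReal.ofReal (2 * r * Real.exp (-(b * r ^ 2))) =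
      ENNReal.ofReal (Real.exp (-(b * a ^ 2)) / b) := by
  have hd : ∀ x ∈ Set.Ioi a, HasDerivAt (fun r => -(Real.exp (-(b * r ^ 2)) / b))
      (2 * x * Real.exp (-(b * x ^ 2))) x := by
    intro x _
    have := ((((hasDerivAt_pow 2 x).const_mul b).neg.exp).div_const b).neg
    refine this.congr_deriv ?_
    simp only [Pi.neg_apply]
    field_simp
    simp
    ring
  have hc : ContinuousWithinAt (fun r => -(Real.exp (-(b * r ^ 2)) / b)) (Set.Ici a) a := by fun_prop
  have hpos : ∀ x ∈ Set.Ioi a, 0 ≤ 2 * x * Real.exp (-(b * x ^ 2)) := fun x hx => by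
    have : 0 < x := ha.trans_lt hx
    positivity
  have ht : Tendsto (fun r => -(Real.exp (-(b * r ^ 2)) / b)) atTop (𝓝 0) := by
    have h1 : Tendsto (fun r : ℝ => b * r ^ 2) atTop atTop :=
      (tendsto_pow_atTop two_ne_zero).const_mul_atTop hb
    simpa using ((Real.tendsto_exp_neg_atTop_nhds_zero.comp h1).div_const b).neg
  rw [← ofReal_integral_eq_lintegral_ofReal (integrableOn_Ioi_deriv_of_nonneg hc hd hpos ht)
    ((ae_restrict_iff' measurableSet_Ioi).2 (ae_of_all _ hpos)),
    integral_Ioi_of_hasDerivAt_of_nonneg hc hd hpos ht]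
  simp

/-- Polar coordinates: the integrand is radial and the angle contributes the factor `2π`. -/
lemma lintegral_complexGaussian_norm {g : ℝ → ℝ≥0∞} (hg : Measurable g) :
    ∫⁻ z, g ‖z‖ ∂complexGaussian =
      ∫⁻ r in Set.Ioi (0 : ℝ), ENNReal.ofReal (2 * r * Real.exp (-r ^ 2)) * g r := by
  have hm : Measurable fun p : ℝ × ℝ => (⟨p.1, p.2⟩ : ℂ) :=
    Complex.measurableEquivRealProd.symm.measurable
  have hpdf : ∀ x : ℝ, gaussianPDF 0 (1 / 2) x =
      ENNReal.ofReal ((√Real.pi)⁻¹ * Real.exp (-x ^ 2)) := by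
    intro x
    rw [gaussianPDF, gaussianPDFReal]
    congr 3 <;> simp [mul_comm √2]
  rw [complexGaussian, lintegral_map (f := fun z : ℂ => g ‖z‖) (hg.comp measurable_norm) hm,
    gaussianReal_of_var_ne_zero _ (by simp), prod_withDensity (measurable_gaussianPDF _ _)
    (measurable_gaussianPDF _ _),
    lintegral_withDensity_eq_lintegral_mul (g := fun p : ℝ × ℝ => g ‖(⟨p.1, p.2⟩ : ℂ)‖) _
      (by fun_prop) ((hg.comp measurable_norm).comp hm),
    ← Measure.volume_eq_prod, ← lintegral_comp_polarCoord_symm]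
  have h1 : ∀ p ∈ polarCoord.target, ENNReal.ofReal p.1 •
      (((fun z : ℝ × ℝ => gaussianPDF 0 (1 / 2) z.1 * gaussianPDF 0 (1 / 2) z.2) *
        fun a : ℝ × ℝ => g ‖(⟨a.1, a.2⟩ : ℂ)‖) (polarCoord.symm p)) =
      (ENNReal.ofReal (2 * p.1 * Real.exp (-p.1 ^ 2)) * g p.1) * ENNReal.ofReal (2 * Real.pi)⁻¹ := by
    rintro ⟨r, t⟩ hp
    have hr : 0 < r := hp.1
    have hn : ‖(⟨r * Real.cos t, r * Real.sin t⟩ : ℂ)‖ = r := by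
      rw [Complex.norm_eq_sqrt_sq_add_sq]
      have : (r * Real.cos t) ^ 2 + (r * Real.sin t) ^ 2 = r ^ 2 := by
        linear_combination r ^ 2 * Real.cos_sq_add_sin_sq t
      simp [this, hr.le]
    have he : Real.exp (-(r * Real.cos t) ^ 2) * Real.exp (-(r * Real.sin t) ^ 2) =
        Real.exp (-r ^ 2) := by
      rw [← Real.exp_add]
      congr 1
      linear_combination -r ^ 2 * Real.cos_sq_add_sin_sq t
    simp only [polarCoord_symm_apply, Pi.mul_apply, hn, hpdf, smul_eq_mul]
    rw [← ENNReal.ofReal_mul (by positivity), ← mul_assoc, ← ENNReal.ofReal_mul hr.le,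
      mul_right_comm _ (g r), ← ENNReal.ofReal_mul (by positivity)]
    congr 2
    have hpi : (√Real.pi)⁻¹ * (√Real.pi)⁻¹ = Real.pi⁻¹ := by
      rw [← mul_inv, Real.mul_self_sqrt Real.pi_pos.le]
    calc r * ((√Real.pi)⁻¹ * Real.exp (-(r * Real.cos t) ^ 2) *
          ((√Real.pi)⁻¹ * Real.exp (-(r * Real.sin t) ^ 2)))
        = r * ((√Real.pi)⁻¹ * (√Real.pi)⁻¹) * (Real.exp (-(r * Real.cos t) ^ 2) *
          Real.exp (-(r * Real.sin t) ^ 2)) := by ring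
      _ = _ := by rw [hpi, he]; field_simp
  rw [setLIntegral_congr_fun polarCoord.open_target.measurableSet h1, polarCoord_target,
    Measure.volume_eq_prod, ← Measure.prod_restrict,
    lintegral_prod_mul (f := fun r => ENNReal.ofReal (2 * r * Real.exp (-r ^ 2)) * g r)
      (g := fun _ => ENNReal.ofReal (2 * Real.pi)⁻¹) (by fun_prop) (by fun_prop)]
  simp only [lintegral_const, Measure.restrict_apply_univ, Real.volume_Ioo, sub_neg_eq_add]
  rw [← ENNReal.ofReal_mul (by positivity), ← two_mul, inv_mul_cancel₀ (by positivity)]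
  simp

lemma complexGaussian_norm_sq_gt {c : ℝ} (hc : 0 ≤ c) :
    complexGaussian {z | c < ‖z‖ ^ 2} = ENNReal.ofReal (Real.exp (-c)) := by
  have hm : MeasurableSet {r : ℝ | c < r ^ 2} := measurableSet_lt (by fun_prop) (by fun_prop)
  have hm' : MeasurableSet {z : ℂ | c < ‖z‖ ^ 2} := measurableSet_lt (by fun_prop) (by fun_prop)
  have h1 := lintegral_complexGaussian_norm (g := {r : ℝ | c < r ^ 2}.indicator 1)
    (measurable_one.indicator hm)
  have h2 : ∀ z : ℂ, {r : ℝ | c < r ^ 2}.indicator (1 : ℝ → ℝ≥0∞) ‖z‖ =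
      {z : ℂ | c < ‖z‖ ^ 2}.indicator 1 z := fun z => rfl
  simp_rw [h2, lintegral_indicator_one hm'] at h1
  have h3 : ∀ r, ENNReal.ofReal (2 * r * Real.exp (-r ^ 2)) * {r : ℝ | c < r ^ 2}.indicator 1 r =
      {r : ℝ | c < r ^ 2}.indicator (fun r => ENNReal.ofReal (2 * r * Real.exp (-r ^ 2))) r := by
    intro r
    by_cases hr : r ∈ {r : ℝ | c < r ^ 2} <;> simp [hr]
  simp_rw [h1, h3]
  rw [lintegral_indicator hm, Measure.restrict_restrict hm]
  have h4 : {r : ℝ | c < r ^ 2} ∩ Set.Ioi 0 = Set.Ioi (√c) := by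
    ext r
    simp only [Set.mem_inter_iff, Set.mem_ofPred_eq, Set.mem_Ioi]
    constructor
    · rintro ⟨h, h0⟩; exact (Real.sqrt_lt' h0).2 h
    · intro h
      have h0 := (Real.sqrt_nonneg c).trans_lt h
      exact ⟨(Real.sqrt_lt' h0).1 h, h0⟩
  rw [h4]
  have := lintegral_Ioi_mul_exp_neg_mul_sq (Real.sqrt_nonneg c) one_pos
  simpa [Real.sq_sqrt hc] using this

lemma lintegral_exp_neg_mul_norm_sq_complexGaussian {b : ℝ} (hb : 0 ≤ b) :
    ∫⁻ z, ENNReal.ofReal (Real.exp (-(b * ‖z‖ ^ 2))) ∂complexGaussian =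
      ENNReal.ofReal (1 + b)⁻¹ := by
  rw [lintegral_complexGaussian_norm (g := fun r => ENNReal.ofReal (Real.exp (-(b * r ^ 2))))
    (by fun_prop)]
  have h1 : ∀ r : ℝ, ENNReal.ofReal (2 * r * Real.exp (-r ^ 2)) *
      ENNReal.ofReal (Real.exp (-(b * r ^ 2))) =
      ENNReal.ofReal (2 * r * Real.exp (-((1 + b) * r ^ 2))) := by
    intro r
    rw [← ENNReal.ofReal_mul' (Real.exp_pos _).le, mul_assoc, ← Real.exp_add]
    congr 3
    ring
  simp_rw [h1]
  rw [lintegral_Ioi_mul_exp_neg_mul_sq le_rfl (by positivity)]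
  simp

lemma lintegral_pi_exp_neg_mul_sum {ι : Type*} [Fintype ι] {b : ℝ} (hb : 0 ≤ b) :
    ∫⁻ v, ENNReal.ofReal (Real.exp (-(b * ∑ i, ‖v i‖ ^ 2)))
      ∂(Measure.pi fun _ : ι => complexGaussian) = ENNReal.ofReal (1 + b)⁻¹ ^ Fintype.card ι := by
  have hi := iIndepFun_pi (μ := fun _ : ι => complexGaussian)
    (X := fun _ z => ENNReal.ofReal (Real.exp (-(b * ‖z‖ ^ 2)))) (fun _ => by fun_prop)
  have h1 := lintegral_prod_eq_prod_lintegral_of_indepFun Finset.univ _ hi (fun _ => by fun_prop)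
  have h2 : ∀ v : ι → ℂ, ENNReal.ofReal (Real.exp (-(b * ∑ i, ‖v i‖ ^ 2))) =
      ∏ i, ENNReal.ofReal (Real.exp (-(b * ‖v i‖ ^ 2))) := by
    intro v
    rw [← ENNReal.ofReal_prod_of_nonneg fun i _ => (Real.exp_pos _).le, ← Real.exp_sum,
      Finset.mul_sum, Finset.sum_neg_distrib]
  simp_rw [h2, h1]
  have h3 : ∀ i : ι, ∫⁻ v, ENNReal.ofReal (Real.exp (-(b * ‖v i‖ ^ 2)))
      ∂(Measure.pi fun _ : ι => complexGaussian) = ENNReal.ofReal (1 + b)⁻¹ := by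
    intro i
    rw [← lintegral_exp_neg_mul_norm_sq_complexGaussian hb]
    exact (measurePreserving_eval (fun _ : ι => complexGaussian) i).lintegral_comp
      (f := fun z => ENNReal.ofReal (Real.exp (-(b * ‖z‖ ^ 2)))) (by fun_prop)
  simp [h3]

lemma enorm2_sq {n : ℕ} (v : Fin n → ℂ) : enorm2 v ^ 2 = ∑ i, ‖v i‖ ^ 2 := by
  rw [enorm2, EuclideanSpace.norm_sq_eq]

/-- The tail of the beamforming gain against the artificial noise power. -/
lemma rayleigh_gain_gt {N : ℕ} {w : Fin N → ℂ} {G : Matrix (Fin N) (Fin (N - 1)) ℂ}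
    (hG : IsNoiseMatrix w G) {c b : ℝ} (hc : 0 ≤ c) (hb : 0 ≤ b) :
    rayleigh N {h | c + b * enorm2 (h ᵥ* G) ^ 2 < ‖h ⬝ᵥ w‖ ^ 2} =
      ENNReal.ofReal (Real.exp (-c) * ((1 + b) ^ (N - 1))⁻¹) := by
  set D : Set (ℂ × (Fin (N - 1) → ℂ)) := {p | c + b * ∑ i, ‖p.2 i‖ ^ 2 < ‖p.1‖ ^ 2}
  have hD : MeasurableSet D := measurableSet_lt (by fun_prop) (by fun_prop)
  set g : (Unit ⊕ Fin (N - 1) → ℂ) → ℂ × (Fin (N - 1) → ℂ) := fun z => (z (Sum.inl ()), fun i => z (Sum.inr i))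
  have hg : MeasurePreserving g (Measure.pi fun _ : Unit ⊕ Fin (N - 1) => complexGaussian)
      (complexGaussian.prod (Measure.pi fun _ : Fin (N - 1) => complexGaussian)) :=
    ((measurePreserving_eval (fun _ : Unit => complexGaussian) ()).prod
      (MeasurePreserving.id _)).comp
      (measurePreserving_sumPiEquivProdPi fun _ : Unit ⊕ Fin (N - 1) => complexGaussian)
  have hQm : Measurable fun h : Fin N → ℂ =>
      h ᵥ* Matrix.fromCols (Matrix.replicateCol Unit w) G := by
    unfold Matrix.vecMul dotProduct
    fun_prop
  have h1 : {h | c + b * enorm2 (h ᵥ* G) ^ 2 < ‖h ⬝ᵥ w‖ ^ 2} =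
      (fun h => h ᵥ* Matrix.fromCols (Matrix.replicateCol Unit w) G) ⁻¹' (g ⁻¹' D) := by
    ext h
    simp only [Set.mem_ofPred_eq, Set.mem_preimage, D, g, Matrix.vecMul_fromCols, Sum.elim_inl,
      Sum.elim_inr, enorm2_sq]
    rfl
  rw [h1, ← Measure.map_apply hQm (hg.measurable hD), map_vecMul_rayleigh hG,
    hg.measure_preimage hD.nullMeasurableSet, Measure.prod_apply_symm hD]
  -- With the noise components `v` fixed, the squared gain has an exponential tail; only a Laplace
  -- transform in `v` remains.
  have h2 : ∀ v : Fin (N - 1) → ℂ, complexGaussian ((fun x => (x, v)) ⁻¹' D) =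
      ENNReal.ofReal (Real.exp (-c)) * ENNReal.ofReal (Real.exp (-(b * ∑ i, ‖v i‖ ^ 2))) := by
    intro v
    rw [← ENNReal.ofReal_mul (Real.exp_pos _).le, ← Real.exp_add, ← neg_add]
    exact complexGaussian_norm_sq_gt (c := c + b * ∑ i, ‖v i‖ ^ 2) (by positivity)
  simp_rw [h2]
  rw [lintegral_const_mul _ (by fun_prop), lintegral_pi_exp_neg_mul_sum hb,
    ENNReal.ofReal_mul (Real.exp_pos _).le, ← ENNReal.ofReal_pow (by positivity)]
  simp [inv_pow]

end Gaussian

/-! ### Exceedances of the eavesdroppers' SINRs -/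

section Eavesdroppers

/-- Polar integration gives `Γ(2/α)`; the prefactor `2/α` is absorbed by `Γ(s + 1) = s Γ(s)`. -/
lemma lintegral_exp_neg_mul_norm_rpow {α c : ℝ} (hα : 0 < α) (hc : 0 < c) :
    ∫⁻ x : EuclideanSpace ℝ (Fin 2), ENNReal.ofReal (Real.exp (-(c * ‖x‖ ^ α))) =
      ENNReal.ofReal (Real.pi * Real.Gamma (1 + 2 / α) * c ^ (-(2 / α))) := by
  have hfun : ∀ y : ℝ, y ^ (Module.finrank ℝ (EuclideanSpace ℝ (Fin 2)) - 1) •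
      Real.exp (-(c * y ^ α)) = y ^ (1 : ℝ) * Real.exp (-c * y ^ α) := by
    intro y
    simp
  have hint : Integrable fun x : EuclideanSpace ℝ (Fin 2) => Real.exp (-(c * ‖x‖ ^ α)) := by
    rw [integrable_fun_norm_addHaar volume (f := fun y => Real.exp (-(c * y ^ α)))]
    simp_rw [hfun]
    exact integrableOn_rpow_mul_exp_neg_mul_rpow (by norm_num) hα hc
  rw [← ofReal_integral_eq_lintegral_ofReal hint (ae_of_all _ fun x => (Real.exp_pos _).le),
    integral_fun_norm_addHaar volume (fun y => Real.exp (-(c * y ^ α)))]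
  simp_rw [hfun]
  rw [integral_rpow_mul_exp_neg_mul_rpow hα (by norm_num) hc, add_comm 1 (2 / α),
    Real.Gamma_add_one (by positivity), measureReal_def, EuclideanSpace.volume_ball_fin_two]
  congr 1
  have h2 : (1 : ℝ) + 1 = 2 := by norm_num
  simp [h2, neg_div, Real.pi_pos.le]
  ring

variable {N : ℕ} {P α ξ : ℝ} {w : Fin N → ℂ} {G : Matrix (Fin N) (Fin (N - 1)) ℂ}

lemma sinrEve_nonneg (hN : 2 ≤ N) (hP : 0 < P) (hξ0 : 0 < ξ) (hξ1 : ξ ≤ 1) (h : Fin N → ℂ)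
    {r : ℝ} (hr : 0 ≤ r) : 0 ≤ sinrEve P α ξ w G h r := by
  have hN' : (0 : ℝ) < (N : ℝ) - 1 := by
    have : (2 : ℝ) ≤ N := by exact_mod_cast hN
    linarith
  have h1 : 0 ≤ 1 - ξ := by linarith
  unfold sinrEve
  positivity

/-- Clearing the denominator and scaling by `r ^ α / (ξ * P)` gives the event treated in
`rayleigh_gain_gt`. -/
lemma lt_sinrEve_iff (hN : 2 ≤ N) (hP : 0 < P) (hξ0 : 0 < ξ) (hξ1 : ξ ≤ 1) (h : Fin N → ℂ)
    {r : ℝ} (hr : 0 < r) (t : ℝ) :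
    t < sinrEve P α ξ w G h r ↔
      t / (ξ * P) * r ^ α + t * ((ξ⁻¹ - 1) / ((N : ℝ) - 1)) * enorm2 (h ᵥ* G) ^ 2 <
        ‖h ⬝ᵥ w‖ ^ 2 := by
  have hN' : (0 : ℝ) < (N : ℝ) - 1 := by
    have : (2 : ℝ) ≤ N := by exact_mod_cast hN
    linarith
  have h1 : 0 ≤ 1 - ξ := by linarith
  have hρ : 0 < r ^ α := Real.rpow_pos_of_pos hr _
  have hk : 0 < r ^ α / (ξ * P) := by positivity
  unfold sinrEve
  rw [lt_div_iff₀ (by positivity), ← mul_lt_mul_iff_of_pos_left hk, Real.rpow_neg hr.le]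
  have e1 : r ^ α / (ξ * P) *
      (t * ((1 - ξ) * P * enorm2 (h ᵥ* G) ^ 2 * (r ^ α)⁻¹ / ((N : ℝ) - 1) + 1)) =
      t / (ξ * P) * r ^ α + t * ((ξ⁻¹ - 1) / ((N : ℝ) - 1)) * enorm2 (h ᵥ* G) ^ 2 := by
    field_simp
    ring
  have e2 : r ^ α / (ξ * P) * (ξ * P * ‖h ⬝ᵥ w‖ ^ 2 * (r ^ α)⁻¹) = ‖h ⬝ᵥ w‖ ^ 2 := by
    field_simp
  rw [e1, e2]

lemma measurable_sinrEve : Measurable fun p : EuclideanSpace ℝ (Fin 2) × (Fin N → ℂ) =>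
    sinrEve P α ξ w G p.2 ‖p.1‖ := by
  have h1 : Measurable fun h : Fin N → ℂ => ‖h ⬝ᵥ w‖ := by
    unfold dotProduct
    fun_prop
  have h2 : Measurable fun h : Fin N → ℂ => enorm2 (h ᵥ* G) ^ 2 := by
    simp_rw [enorm2_sq]
    unfold Matrix.vecMul dotProduct
    fun_prop
  have h3 : Measurable fun p : EuclideanSpace ℝ (Fin 2) × (Fin N → ℂ) => ‖p.2 ⬝ᵥ w‖ :=
    h1.comp measurable_snd
  have h4 : Measurable fun p : EuclideanSpace ℝ (Fin 2) × (Fin N → ℂ) => enorm2 (p.2 ᵥ* G) ^ 2 :=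
    h2.comp measurable_snd
  unfold sinrEve
  fun_prop

/-- The mean number of eavesdroppers whose SINR exceeds the level `t`. -/
noncomputable def meanExceedances (N : ℕ) (P α ξ lam t : ℝ) : ℝ :=
  lam * (((1 + t * ((ξ⁻¹ - 1) / ((N : ℝ) - 1))) ^ (N - 1))⁻¹ *
    (Real.pi * Real.Gamma (1 + 2 / α) * (t / (ξ * P)) ^ (-(2 / α))))

lemma lintegral_rayleigh_sinrEve_gt (hN : 2 ≤ N) (hP : 0 < P) (hα : 2 < α) (hξ0 : 0 < ξ)
    (hξ1 : ξ ≤ 1) (hG : IsNoiseMatrix w G) {lam t : ℝ} (hlam : 0 < lam) (ht : 0 < t) :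
    ∫⁻ x, rayleigh N (Prod.mk x ⁻¹' {p : EuclideanSpace ℝ (Fin 2) × (Fin N → ℂ) |
        t < sinrEve P α ξ w G p.2 ‖p.1‖}) ∂(ENNReal.ofReal lam • volume) =
      ENNReal.ofReal (meanExceedances N P α ξ lam t) := by
  have hN' : (0 : ℝ) < (N : ℝ) - 1 := by
    have : (2 : ℝ) ≤ N := by exact_mod_cast hN
    linarith
  have hφ : 0 ≤ (ξ⁻¹ - 1) / ((N : ℝ) - 1) :=
    div_nonneg (by linarith [(one_le_inv₀ hξ0).2 hξ1]) hN'.le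
  have hb : 0 ≤ t * ((ξ⁻¹ - 1) / ((N : ℝ) - 1)) := by positivity
  have h1 : ∀ᵐ x : EuclideanSpace ℝ (Fin 2), rayleigh N (Prod.mk x ⁻¹'
      {p : EuclideanSpace ℝ (Fin 2) × (Fin N → ℂ) | t < sinrEve P α ξ w G p.2 ‖p.1‖}) =
      ENNReal.ofReal (Real.exp (-(t / (ξ * P) * ‖x‖ ^ α))) *
        ENNReal.ofReal ((1 + t * ((ξ⁻¹ - 1) / ((N : ℝ) - 1))) ^ (N - 1))⁻¹ := by
    -- At the origin `‖x‖ ^ (-α)` takes a default value, but a single point is null.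
    filter_upwards [Measure.ae_ne volume (0 : EuclideanSpace ℝ (Fin 2))] with x hx
    rw [← ENNReal.ofReal_mul (Real.exp_pos _).le, ← rayleigh_gain_gt hG (by positivity) hb]
    congr 1
    ext h
    exact lt_sinrEve_iff hN hP hξ0 hξ1 h (norm_pos_iff.2 hx) t
  rw [lintegral_smul_measure, lintegral_congr_ae h1, lintegral_mul_const _ (by fun_prop),
    lintegral_exp_neg_mul_norm_rpow (by linarith) (by positivity), smul_eq_mul, meanExceedances,
    ENNReal.ofReal_mul hlam.le, mul_comm (ENNReal.ofReal (Real.pi * _ * _)),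
    ← ENNReal.ofReal_mul (by positivity)]

variable {Ω : Type*} [MeasurableSpace Ω] {μ : Measure Ω} [IsProbabilityMeasure μ]
  {X : ℕ → Ω → EuclideanSpace ℝ (Fin 2)} {h : ℕ → Ω → Fin N → ℂ} {lam : ℝ}

lemma ae_exists_isGreatest_sinrEve (hN : 2 ≤ N) (hP : 0 < P) (hα : 2 < α) (hξ0 : 0 < ξ)
    (hξ1 : ξ ≤ 1) (hG : IsNoiseMatrix w G) (hlam : 0 < lam) (hX : IsHomogeneousPPP X lam μ)
    (hlaw : ∀ k, HasLaw (h k) (rayleigh N) μ)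
    (hXh : IndepFun (fun s k => X k s) (fun s k => h k s) μ) :
    ∀ᵐ s ∂μ, ∃ k, IsGreatest (Set.range fun j => sinrEve P α ξ w G (h j s) ‖X j s‖)
      (sinrEve P α ξ w G (h k s) ‖X k s‖) := by
  have : SigmaFinite (ENNReal.ofReal lam • (volume : Measure (EuclideanSpace ℝ (Fin 2)))) :=
    inferInstanceAs (SigmaFinite (lam.toNNReal • volume))
  -- Campbell's formula makes the exceedance probabilities summable, so Borel–Cantelli applies.
  have hfin : ∀ n : ℕ, ∀ᵐ s ∂μ,
      {k | 1 / ((n : ℝ) + 1) < sinrEve P α ξ w G (h k s) ‖X k s‖}.Finite := by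
    intro n
    have hA : MeasurableSet {p : EuclideanSpace ℝ (Fin 2) × (Fin N → ℂ) |
        1 / ((n : ℝ) + 1) < sinrEve P α ξ w G p.2 ‖p.1‖} :=
      measurableSet_lt measurable_const measurable_sinrEve
    refine ae_finite_setOfPred_mem (s := fun k => {s | 1 / ((n : ℝ) + 1) <
      sinrEve P α ξ w G (h k s) ‖X k s‖}) ?_
    have := IsPoissonProcess.tsum_measure_mem hX hlaw hXh hA
    rw [lintegral_rayleigh_sinrEve_gt hN hP hα hξ0 hξ1 hG hlam (by positivity)] at this
    exact this.trans_ne ENNReal.ofReal_ne_top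
  -- The law of `X 0` is one summand of the intensity measure, which does not charge points.
  have hX0 : ∀ᵐ s ∂μ, X 0 s ≠ 0 := by
    have h1 : μ.map (X 0) {0} = 0 := by
      have h2 : (ENNReal.ofReal lam • volume) {(0 : EuclideanSpace ℝ (Fin 2))} = 0 := by simp
      rw [← IsPoissonProcess.sum_map_eq hX, Measure.sum_apply_eq_zero] at h2
      exact h2 0
    have := (Measure.map_apply (hX.measurable 0) (measurableSet_singleton _)).symm.trans h1
    exact measure_eq_zero_iff_ae_notMem.1 this
  have hh0 : ∀ᵐ s ∂μ, 0 < ‖h 0 s ⬝ᵥ w‖ ^ 2 := by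
    have h1 : ∀ᵐ v ∂rayleigh N, 0 < ‖v ⬝ᵥ w‖ ^ 2 := by
      have := rayleigh_gain_gt hG le_rfl le_rfl
      simp only [zero_mul, add_zero, neg_zero, Real.exp_zero, one_pow, inv_one, mul_one,
        ENNReal.ofReal_one] at this
      refine (prob_compl_eq_zero_iff ?_).2 this
      unfold dotProduct
      exact measurableSet_lt (by fun_prop) (by fun_prop)
    rw [← (hlaw 0).map_eq] at h1
    exact ae_of_ae_map (hlaw 0).aemeasurable h1
  filter_upwards [ae_all_iff.2 hfin, hX0, hh0] with s hs hs0 hs1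
  have hpos : 0 < sinrEve P α ξ w G (h 0 s) ‖X 0 s‖ := by
    rw [lt_sinrEve_iff hN hP hξ0 hξ1 _ (norm_pos_iff.2 hs0)]
    simpa using hs1
  -- Some level lies below the SINR of Eve `0`; the finite set above it is nonempty, and its maximum
  -- is global.
  obtain ⟨n, hn⟩ := exists_nat_one_div_lt hpos
  obtain ⟨k, hk, hmax⟩ := Set.exists_max_image _
    (fun k => sinrEve P α ξ w G (h k s) ‖X k s‖) (hs n) ⟨0, hn⟩
  refine ⟨k, ⟨k, rfl⟩, ?_⟩
  rintro _ ⟨j, rfl⟩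
  by_cases hj : 1 / ((n : ℝ) + 1) < sinrEve P α ξ w G (h j s) ‖X j s‖
  · exact hmax j hj
  · exact (not_lt.1 hj).trans (le_of_lt hk)

lemma measureReal_exists_sinrEve_gt (hN : 2 ≤ N) (hP : 0 < P) (hα : 2 < α) (hξ0 : 0 < ξ)
    (hξ1 : ξ ≤ 1) (hG : IsNoiseMatrix w G) (hlam : 0 < lam) (hX : IsHomogeneousPPP X lam μ)
    (hlaw : ∀ k, HasLaw (h k) (rayleigh N) μ) (hind : iIndepFun h μ)
    (hXh : IndepFun (fun s k => X k s) (fun s k => h k s) μ) {t : ℝ} (ht : 0 < t) :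
    μ.real {s | ∃ k, t < sinrEve P α ξ w G (h k s) ‖X k s‖} =
      1 - Real.exp (-meanExceedances N P α ξ lam t) := by
  have : SigmaFinite (ENNReal.ofReal lam • (volume : Measure (EuclideanSpace ℝ (Fin 2)))) :=
    inferInstanceAs (SigmaFinite (lam.toNNReal • volume))
  have hN' : (0 : ℝ) < (N : ℝ) - 1 := by
    have : (2 : ℝ) ≤ N := by exact_mod_cast hN
    linarith
  have hφ : 0 ≤ (ξ⁻¹ - 1) / ((N : ℝ) - 1) :=
    div_nonneg (by linarith [(one_le_inv₀ hξ0).2 hξ1]) hN'.le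
  have hΛ : 0 ≤ meanExceedances N P α ξ lam t := by
    unfold meanExceedances
    have := Real.Gamma_pos_of_pos (show 0 < 1 + 2 / α by positivity)
    positivity
  -- `HasLaw` gives only a.e. measurability; measurable versions are used for the void probability.
  choose h' hm heq using fun k => (hlaw k).aemeasurable
  have hlaw' : ∀ k, HasLaw (h' k) (rayleigh N) μ := fun k => (hlaw k).congr (heq k).symm
  have hall : ∀ᵐ s ∂μ, ∀ k, h k s = h' k s := ae_all_iff.2 heq
  have hXh' : IndepFun (fun s k => X k s) (fun s k => h' k s) μ :=
    hXh.congr ae_eq_rfl (hall.mono fun s hs => funext hs)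
  set A := {p : EuclideanSpace ℝ (Fin 2) × (Fin N → ℂ) | t < sinrEve P α ξ w G p.2 ‖p.1‖}
  have hA : MeasurableSet A := measurableSet_lt measurable_const measurable_sinrEve
  have h1 : {s | ∃ k, t < sinrEve P α ξ w G (h k s) ‖X k s‖} =ᵐ[μ]
      ({s | ∀ k, (X k s, h' k s) ∉ A}ᶜ : Set Ω) := by
    filter_upwards [hall] with s hs
    apply propext
    change (∃ k, t < sinrEve P α ξ w G (h k s) ‖X k s‖) ↔ ¬ ∀ k, (X k s, h' k s) ∉ A
    simp only [hs, not_forall, not_not]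
    rfl
  have hmeas : MeasurableSet {s | ∀ k, (X k s, h' k s) ∉ A} := by
    rw [Set.ofPred_forall]
    exact MeasurableSet.iInter fun k => ((hX.measurable k).prodMk (hm k)) hA.compl
  have h2 : μ {s | ∀ k, (X k s, h' k s) ∉ A} =
      ENNReal.ofReal (Real.exp (-meanExceedances N P α ξ lam t)) := by
    rw [IsPoissonProcess.measure_forall_notMem hX hlaw' hm (hind.congr heq) hXh' hA,
      lintegral_rayleigh_sinrEve_gt hN hP hα hξ0 hξ1 hG hlam ht, nexp_ofReal hΛ]
  rw [measureReal_congr h1, probReal_compl_eq_one_sub hmeas, measureReal_def, h2,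
    ENNReal.toReal_ofReal (Real.exp_pos _).le]

end Eavesdroppers

/-! ### Threshold and closed form -/

lemma capacity_gt_sub_iff {g γB RS T : ℝ} (hT : T = (2 : ℝ) ^ RS) (hg : 0 ≤ g) (hγB : 0 ≤ γB) :
    capacity g > capacity γB - RS ↔ (1 + γB) / T - 1 < g := by
  have hT0 : 0 < T := hT ▸ Real.rpow_pos_of_pos two_pos RS
  have h1 : capacity γB - RS = Real.logb 2 ((1 + γB) / T) := by
    rw [capacity, Real.logb_div (by positivity) hT0.ne', hT, Real.logb_rpow two_pos (by norm_num)]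
  rw [h1, capacity, gt_iff_lt, Real.logb_lt_logb_iff (by norm_num) (by positivity) (by positivity),
    sub_lt_iff_lt_add']

lemma kappa_pos {N : ℕ} {P τ rB α : ℝ} {hb : Fin N → ℂ} (hP : 0 < P) (hτ0 : 0 ≤ τ) (hτ1 : τ < 1)
    (hrB : 0 < rB) (hhb : hb ≠ 0) : 0 < kappa P τ rB α hb := by
  have h1 : 0 < 1 - τ ^ 2 := by nlinarith
  have h2 : 0 < enorm2 hb := norm_pos_iff.2 fun h => hhb (by simpa using h)
  unfold kappa
  positivity

lemma meanExceedances_eq {N : ℕ} (hN : 2 ≤ N) {P α ξ lam ω δ β θ : ℝ} (hP : 0 < P)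
    (hω : 0 < ω) (hωξ : ω < ξ) (hθ : 0 < θ) (hδ : δ = 2 / α)
    (hβ : β = Real.pi * Real.Gamma (1 + δ)) :
    meanExceedances N P α ξ lam (θ * (ξ * ω⁻¹ - 1)) = β * lam * (P * θ⁻¹) ^ δ * J N δ θ ω ξ := by
  have hξ0 : 0 < ξ := hω.trans hωξ
  have hd : 0 < ω⁻¹ - ξ⁻¹ := sub_pos.2 (inv_strictAnti₀ hω hωξ)
  -- Dividing by `ξ` turns `ξ / ω - 1` into `ω⁻¹ - ξ⁻¹`; the power `-δ` then splits into the two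
  -- factors of the formula.
  have h1 : θ * (ξ * ω⁻¹ - 1) / (ξ * P) = (P * θ⁻¹)⁻¹ * (ω⁻¹ - ξ⁻¹) := by
    field_simp
  have h2 : ((P * θ⁻¹)⁻¹ * (ω⁻¹ - ξ⁻¹)) ^ (-δ) = (P * θ⁻¹) ^ δ * (ω⁻¹ - ξ⁻¹) ^ (-δ) := by
    rw [Real.mul_rpow (by positivity) hd.le, Real.inv_rpow (by positivity),
      ← Real.rpow_neg (by positivity), neg_neg]
  have h3 : ∀ x : ℝ, x ^ (1 - (N : ℤ)) = (x ^ (N - 1))⁻¹ := by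
    intro x
    rw [← zpow_natCast, ← zpow_neg, Nat.cast_sub (by omega)]
    simp
  rw [meanExceedances, J, h1, ← hδ, h2, h3, hβ, mul_comm θ]
  ring

end SecrecyOutage

theorem lemma1 {Ω : Type*} [MeasurableSpace Ω] (μ : Measure Ω) [IsProbabilityMeasure μ]
    (N : ℕ) (hN : 2 ≤ N)
    (P α τ rB RS lamE ξ : ℝ)
    (hP : 0 < P) (hα : 2 < α) (hτ0 : 0 ≤ τ) (hτ1 : τ < 1) (hrB : 0 < rB) (hRS : 0 < RS)
    (hlam : 0 < lamE) (hξ1 : ξ ≤ 1)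
    -- the estimated main channel and the artificial-noise matrix
    (hb : Fin N → ℂ) (hhb : hb ≠ 0)
    (G : Matrix (Fin N) (Fin (N - 1)) ℂ) (hG : SecrecyOutage.IsNoiseMatrix (SecrecyOutage.beam hb) G)
    -- the locations of the eavesdroppers
    (X : ℕ → Ω → EuclideanSpace ℝ (Fin 2)) (hX : SecrecyOutage.IsHomogeneousPPP X lamE μ)
    -- the small-scale fading vectors of the eavesdroppers: i.i.d. and independent of the locations
    (h : ℕ → Ω → Fin N → ℂ) (hlaw : ∀ k, HasLaw (h k) (SecrecyOutage.rayleigh N) μ)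
    (hind : iIndepFun h μ)
    (hXh : IndepFun (fun s k => X k s) (fun s k => h k s) μ)
    -- the derived parameters
    (κ T ω δ β θ : ℝ) (hκ : κ = SecrecyOutage.kappa P τ rB α hb)
    (hT : T = (2 : ℝ) ^ RS) (hω : ω = (T - 1) / κ) (hδ : δ = 2 / α)
    (hβ : β = Real.pi * Real.Gamma (1 + δ)) (hθ : θ = (T - 1) / T)
    (γ : ℕ → Ω → ℝ)
    (hγ : γ = fun k s => SecrecyOutage.sinrEve P α ξ (SecrecyOutage.beam hb) G (h k s) ‖X k s‖)
    (hξ : ω < ξ) :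
    (∀ᵐ s ∂μ, ∃ k, IsGreatest (Set.range fun j => γ j s) (γ k s)) ∧
    SecrecyOutage.sop μ γ (SecrecyOutage.sinrBob ξ κ) RS =
      1 - Real.exp (-β * lamE * (P * θ⁻¹) ^ δ * SecrecyOutage.J N δ θ ω ξ) := by
  subst hγ
  have hT1 : 1 < T := hT ▸ Real.one_lt_rpow (by norm_num) hRS
  have hκ0 : 0 < κ := hκ ▸ SecrecyOutage.kappa_pos hP hτ0 hτ1 hrB hhb
  have hω0 : 0 < ω := hω ▸ div_pos (by linarith) hκ0
  have hξ0 : 0 < ξ := hω0.trans hξ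
  have hθ0 : 0 < θ := hθ ▸ div_pos (by linarith) (by linarith)
  have hmax := SecrecyOutage.ae_exists_isGreatest_sinrEve hN hP hα hξ0 hξ1 hG hlam hX hlaw hXh
  refine ⟨hmax, ?_⟩
  have ht : (1 + SecrecyOutage.sinrBob ξ κ) / T - 1 = θ * (ξ * ω⁻¹ - 1) := by
    have h1 : T - 1 ≠ 0 := by linarith
    have h2 : T ≠ 0 := by linarith
    rw [SecrecyOutage.sinrBob, hθ, hω]
    field_simp
    ring
  have ht0 : 0 < θ * (ξ * ω⁻¹ - 1) := by
    have : 1 < ξ * ω⁻¹ := by rwa [← div_eq_mul_inv, one_lt_div hω0]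
    exact mul_pos hθ0 (by linarith)
  have hγB : 0 ≤ SecrecyOutage.sinrBob ξ κ := (mul_pos hξ0 hκ0).le
  have hset : {s | SecrecyOutage.capacity (⨆ k, SecrecyOutage.sinrEve P α ξ
        (SecrecyOutage.beam hb) G (h k s) ‖X k s‖) >
        SecrecyOutage.capacity (SecrecyOutage.sinrBob ξ κ) - RS} =ᵐ[μ]
      {s | ∃ k, θ * (ξ * ω⁻¹ - 1) < SecrecyOutage.sinrEve P α ξ
        (SecrecyOutage.beam hb) G (h k s) ‖X k s‖} := by
    filter_upwards [hmax] with s ⟨k, hk⟩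
    apply propext
    change SecrecyOutage.capacity (⨆ k, SecrecyOutage.sinrEve P α ξ
        (SecrecyOutage.beam hb) G (h k s) ‖X k s‖) >
        SecrecyOutage.capacity (SecrecyOutage.sinrBob ξ κ) - RS ↔
      ∃ k, θ * (ξ * ω⁻¹ - 1) < SecrecyOutage.sinrEve P α ξ
        (SecrecyOutage.beam hb) G (h k s) ‖X k s‖
    -- An unbounded real supremum would default to `0`; the attained maximum makes `⨆` the true one.
    rw [iSup, hk.csSup_eq, SecrecyOutage.capacity_gt_sub_iff hT
      (SecrecyOutage.sinrEve_nonneg hN hP hξ0 hξ1 _ (norm_nonneg _)) hγB, ht]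
    exact ⟨fun hs => ⟨k, hs⟩, fun ⟨j, hj⟩ => hj.trans_le (hk.2 ⟨j, rfl⟩)⟩
  rw [SecrecyOutage.sop, measureReal_congr hset,
    SecrecyOutage.measureReal_exists_sinrEve_gt hN hP hα hξ0 hξ1 hG hlam hX hlaw hind hXh ht0,
    SecrecyOutage.meanExceedances_eq hN hP hω0 hξ hθ0 hδ hβ]
  congr 2
  ring
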